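/- For $n\ge 1$ let $\mathfrak B_n$ be the group of permutations $\pi$ of $\{-n,\dots,-1,1,\dots,n\}$ with $\pi(-i)=-\pi(i)$ for all $i$, write $\pi_i=\pi(i)$ and $[n]=\{1,\dots,n\}$, and let $\mathfrak D_n$ be the set of $\pi\in\mathfrak B_n$ for which $|\{i\in[n]:\pi_i<0\}|$ is even. For $\pi\in\mathfrak D_n$ let $$\mathrm{inv}_D(\pi)=|\{1\le i<j\le n:\pi_i>\pi_j\}|+|\{1\le i<j\le n:-\pi_i>\pi_j\}|$$ be its length, and let $$\mathrm{exc}_D(\pi)=|\{i\in[n]:\pi_{|\pi_i|}>\pi_i\}|+|\{i\in[n]:\pi_i=-i\}|,\qquad \mathrm{nexc}_D(\pi)=n-\mathrm{exc}_D(\pi).$$ Let $\mathfrak D_n^+$ and $\mathfrak D_n^-$ be the sets of elements of $\mathfrak D_n$ of even and of odd length, and put $$\mathrm{DExc}_n^{\pm}(s,t)=\sum_{\pi\in\mathfrak D_n^{\pm}}t^{\mathrm{exc}_D(\pi)}s^{\mathrm{nexc}_D(\pi)}\in\mathbb Q[s,t].$$ For a nonzero homogeneous polynomial $f(s,t)=\sum_{i=0}^{d}a_is^{d-i}t^i\in\mathbb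 Q[s,t]$, the center of symmetry of $f$ is $(N+r)/2$, where $N$ and $r$ are the largest and the smallest index $i$ with $a_i\ne0$. Such an $f$ is gamma positive if, its center of symmetry being $m/2$, there are rational numbers $\gamma_i\ge0$ with $f(s,t)=\sum_{i=0}^{\lfloor m/2\rfloor}\gamma_i(st)^i(s+t)^{m-2i}$. **Theorem.** For every even integer $n\ge4$, the polynomials $\mathrm{DExc}_n^+(s,t)$ and $\mathrm{DExc}_n^-(s,t)$ are both gamma positive with center of symmetry $n/2$. -/

import Mathlib

noncomputable section

/-- The letters `-n, …, -1, 1, …, n` on which signed permutations act. -/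
abbrev SignedLetter (n : ℕ) : Type :=
  {k : ℤ // k ∈ (Finset.Icc (-(n : ℤ)) (n : ℤ)).erase 0}

namespace SignedLetter

/-- The letter `-k`. -/
def neg {n : ℕ} (k : SignedLetter n) : SignedLetter n :=
  ⟨-k.1, by
    have h := k.2
    simp only [Finset.mem_erase, Finset.mem_Icc, ne_eq] at h ⊢
    omega⟩

/-- The letter `|k|`. -/
def abs {n : ℕ} (k : SignedLetter n) : SignedLetter n :=
  ⟨|k.1|, by
    have h := k.2
    simp only [Finset.mem_erase, Finset.mem_Icc, ne_eq] at h ⊢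
    rcases abs_cases k.1 with h' | h' <;> omega⟩

end SignedLetter

/-- The hyperoctahedral group: the permutations `π` of `{-n, …, -1, 1, …, n}` such that
`π (-i) = -π i` for all `i`. -/
abbrev SignedPerm (n : ℕ) : Type :=
  {π : Equiv.Perm (SignedLetter n) // ∀ i : SignedLetter n, π i.neg = (π i).neg}

namespace SignedPerm

variable {n : ℕ}

/-- The set of positions `[n] = {1, …, n}`. -/
def positions (n : ℕ) : Finset (SignedLetter n) :=
  {i | 0 < i.1}

/-- The set of the negative entries of `π`, that is, of the `π i` with `i > 0` and `π i < 0`. -/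
def negs (π : SignedPerm n) : Finset (SignedLetter n) :=
  ((positions n).filter fun i => (π.1 i).1 < 0).image fun i => π.1 i

/-- The number of inversions: pairs `1 ≤ i < j ≤ n` with `π i > π j`. -/
def inv (π : SignedPerm n) : ℕ :=
  ((positions n ×ˢ positions n).filter
    fun p => p.1.1 < p.2.1 ∧ (π.1 p.1).1 > (π.1 p.2).1).card

/-- The type-D length: the number of inversions plus the number of pairs `1 ≤ i < j ≤ n`
with `-π i > π j`. -/
def invD (π : SignedPerm n) : ℕ :=
  inv π + ((positions n ×ˢ positions n).filter
    fun p => p.1.1 < p.2.1 ∧ -(π.1 p.1).1 > (π.1 p.2).1).card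

/-- The number of excedances:
`|{i ∈ [n] : π (|π i|) > π i}| + |{i ∈ [n] : π i = -i}|`. -/
def excD (π : SignedPerm n) : ℕ :=
  ((positions n).filter fun i => (π.1 (π.1 i).abs).1 > (π.1 i).1).card +
    ((positions n).filter fun i => (π.1 i).1 = -i.1).card

/-- The number of non-excedances, `n - excD π`; by `excD_le` below, the subtraction
never truncates. -/
def nexcD (π : SignedPerm n) : ℕ :=
  n - excD π

theorem card_positions (n : ℕ) : (positions n).card = n := by
  have h : (positions n).map (Function.Embedding.subtype _) = Finset.Icc (1 : ℤ) n := by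
    ext k
    simp only [positions, Finset.mem_map, Finset.mem_filter, Finset.mem_univ, true_and,
      Function.Embedding.subtype_apply, Finset.mem_Icc]
    constructor
    · rintro ⟨a, ha, rfl⟩
      have := a.2
      simp only [Finset.mem_erase, Finset.mem_Icc] at this
      omega
    · intro hk
      refine ⟨⟨k, ?_⟩, ?_, rfl⟩
      · simp only [Finset.mem_erase, Finset.mem_Icc]
        omega
      · change 0 < k
        omega
  rw [← Finset.card_map (Function.Embedding.subtype _), h]
  simp

theorem excD_le (π : SignedPerm n) : excD π ≤ n := by
  rw [excD, ← Finset.card_union_of_disjoint]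
  · refine (Finset.card_le_card (Finset.union_subset ?_ ?_)).trans (card_positions n).le <;>
      exact Finset.filter_subset _ _
  · refine Finset.disjoint_filter.2 fun i hi h h' => ?_
    have hi : 0 < i.1 := by simpa [positions] using hi
    have : (π.1 i).abs = i := Subtype.ext (by
      change |(π.1 i).1| = i.1
      rw [h', abs_neg, abs_of_pos hi])
    rw [this] at h
    exact lt_irrefl _ h

end SignedPerm

/-- The type-D Coxeter group: the signed permutations with an even number of negative entries. -/
def typeD (n : ℕ) : Finset (SignedPerm n) :=
  {π | Even π.negs.card}

/-- The elements of even length of the type-D Coxeter group. -/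
def typeDPlus (n : ℕ) : Finset (SignedPerm n) :=
  (typeD n).filter fun π => Even π.invD

/-- The elements of odd length of the type-D Coxeter group. -/
def typeDMinus (n : ℕ) : Finset (SignedPerm n) :=
  typeD n \ typeDPlus n

namespace Bivariate

/-- The variable `s` of `ℚ[s, t]`. -/
def s : MvPolynomial (Fin 2) ℚ := MvPolynomial.X 0

/-- The variable `t` of `ℚ[s, t]`. -/
def t : MvPolynomial (Fin 2) ℚ := MvPolynomial.X 1

/-- The largest exponent of `t` in a monomial of `f`. -/
def tDegree (f : MvPolynomial (Fin 2) ℚ) : ℕ :=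
  MvPolynomial.degreeOf 1 f

/-- The least exponent of `t` in a monomial of `f` (for `f ≠ 0`). -/
def tOrder (f : MvPolynomial (Fin 2) ℚ) : ℕ :=
  sInf {k | ∃ m ∈ f.support, m 1 = k}

/-- The center of symmetry of a nonzero homogeneous `f`: the mean of the largest and of the least
index `i` whose coefficient `a_i` in `f = ∑ a_i s ^ (d - i) t ^ i` is nonzero. -/
def centerOfSymmetry (f : MvPolynomial (Fin 2) ℚ) : ℚ :=
  ((tDegree f : ℚ) + (tOrder f : ℚ)) / 2

/-- A nonzero `f` with center of symmetry `n / 2` is gamma positive if it is a combination with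
nonnegative coefficients of the polynomials `(s t) ^ i (s + t) ^ (n - 2 i)`, `0 ≤ i ≤ n / 2`
(in particular `f` is homogeneous of degree `n`). -/
def IsGammaPositive (f : MvPolynomial (Fin 2) ℚ) : Prop :=
  f ≠ 0 ∧ ∃ n : ℕ, centerOfSymmetry f = (n : ℚ) / 2 ∧
    ∃ γ : ℕ → ℚ, (∀ i, 0 ≤ γ i) ∧
      f = ∑ i ∈ Finset.range (n / 2 + 1),
        MvPolynomial.C (γ i) * ((s * t) ^ i * (s + t) ^ (n - 2 * i))

end Bivariate

/-- The excedance polynomial over the even-length elements of the type-D Coxeter group. -/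
def DExcPlus (n : ℕ) : MvPolynomial (Fin 2) ℚ :=
  ∑ π ∈ typeDPlus n, Bivariate.t ^ π.excD * Bivariate.s ^ π.nexcD

/-- The excedance polynomial over the odd-length elements of the type-D Coxeter group. -/
def DExcMinus (n : ℕ) : MvPolynomial (Fin 2) ℚ :=
  ∑ π ∈ typeDMinus n, Bivariate.t ^ π.excD * Bivariate.s ^ π.nexcD

end

/-!
A signed permutation `π` amounts to the permutation `σ = |π|` of `[n]` together with a sign `ε j`
for each value `j` (`SignedPerm.ofPair`). If `i` runs over `[n]` and `v i = ε i * i`, then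
`excD π` counts the `i` with `v i < v (σ i)` together with the negative fixed points of `σ` acting
on the `v i`. Moreover `(-1) ^ invD π` is the sign of `σ`, and `-1` to the number of negative
entries is the product of the `ε i`. Hence `4 * DExcPlus n` and `4 * DExcMinus n` are combinations
with coefficients `± 1` of four sums `Q = twistedExc a b n` over the whole hyperoctahedral group,
in which `π` carries the character `(-1) ^ (a * negs π) * sign |π| ^ b`.

A letter whose absolute value exceeds all others is either a fixed point or is inserted after some
`x` in a cycle of `σ`, and then it turns the weight (`s` or `t`) of the step at `x` into `s * t`.
On the generating function this is the operator `s * t * (∂/∂s + ∂/∂t)`. With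
`D = ∂/∂s + ∂/∂t`, `permSum_cons` therefore gives the recurrence (`twistedExc_succ`)
`Q (n + 1) = (s + (-1) ^ a * t) * Q n + (1 + (-1) ^ a) * (-1) ^ b * s * t * D (Q n)`.

For even `n` the three nontrivial characters all give `Q n = (s - t) ^ n`. For the trivial
character, `D (s + t) = 2` and `D (s * t) = s + t` turn the recurrence into one for gamma
coefficients, whose solution is `4 ^ i * leftPeak n i`. So the theorem is about
`4 * DExcPlus n = Q n + 3 * (s - t) ^ n` and `4 * DExcMinus n = Q n - (s - t) ^ n`. As
`(s - t) ^ (2 * m) = ((s + t) ^ 2 - 4 * s * t) ^ m` has the gamma coefficients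
`(-4) ^ i * m.choose i`, nonnegativity reduces to `3 * m.choose i ≤ leftPeak (2 * m) i` for `1 ≤ i`
and `2 ≤ m` (`three_mul_choose_le_leftPeak`). The center of symmetry is read off from the first
nonzero gamma coefficient, of index `0` for `DExcPlus` and `1` for `DExcMinus`.
-/

noncomputable section

/-! ### The insertion recurrence for the signed excedance sums -/

namespace Bivariate

/-- The derivation `∂/∂s + ∂/∂t` of `ℚ[s, t]`. -/
def diagDeriv : Derivation ℚ (MvPolynomial (Fin 2) ℚ) (MvPolynomial (Fin 2) ℚ) :=
  MvPolynomial.mkDerivation ℚ fun _ => 1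

@[simp] theorem diagDeriv_s : diagDeriv s = 1 := MvPolynomial.mkDerivation_X _ _ _

@[simp] theorem diagDeriv_t : diagDeriv t = 1 := MvPolynomial.mkDerivation_X _ _ _

theorem diagDeriv_prod {ι : Type*} [DecidableEq ι] (S : Finset ι)
    (f : ι → MvPolynomial (Fin 2) ℚ) (hf : ∀ i, diagDeriv (f i) = 1) :
    diagDeriv (∏ i ∈ S, f i) = ∑ i ∈ S, ∏ j ∈ S.erase i, f j := by
  induction S using Finset.induction_on with
  | empty => simp
  | insert a S ha ih =>
    rw [Finset.prod_insert ha, Derivation.leibniz, ih, hf, Finset.sum_insert ha,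
      Finset.erase_insert ha, smul_eq_mul, smul_eq_mul, mul_one, add_comm, Finset.mul_sum]
    refine congrArg₂ _ rfl (Finset.sum_congr rfl fun i hi => ?_)
    rw [Finset.erase_insert_of_ne (by rintro rfl; exact ha hi),
      Finset.prod_insert (fun h => ha (Finset.mem_of_mem_erase h))]

/-- The weight of a step `x ↦ y` of a permutation of a set of nonzero integers: `t` at an
excedance, `s` otherwise, where a fixed point is an excedance when it is negative. -/
def stepWeight (x y : ℤ) : MvPolynomial (Fin 2) ℚ :=
  if x < y ∨ (x = y ∧ x < 0) then t else s

theorem diagDeriv_stepWeight (x y : ℤ) : diagDeriv (stepWeight x y) = 1 := by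
  unfold stepWeight
  split_ifs <;> simp

/-- A letter of extreme absolute value is an excedance on exactly one of the two steps through
it. -/
theorem stepWeight_mul_stepWeight {x y c : ℤ} (hx : |x| < |c|) (hy : |y| < |c|) :
    stepWeight c y * stepWeight x c = s * t := by
  rw [abs_lt] at hx hy
  unfold stepWeight
  rcases abs_cases c with h | h
  · rw [if_neg (by omega), if_pos (by omega)]
  · rw [if_pos (by omega), if_neg (by omega), mul_comm]

/-- The excedance polynomial of the permutations of the integers `v 0, …, v (n - 1)`, where each
permutation `σ` is counted with the coefficient `sign σ ^ b`. -/
def permSum (b : ℕ) {n : ℕ} (v : Fin n → ℤ) : MvPolynomial (Fin 2) ℚ :=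
  ∑ σ : Equiv.Perm (Fin n),
    ((Equiv.Perm.sign σ ^ b : ℤˣ) : ℤ) • ∏ x, stepWeight (v x) (v (σ x))

/-- A new letter of extreme absolute value is either a fixed point, or it is inserted into a cycle
after some `x`; the latter replaces the weight of the step at `x` by `s * t`. -/
theorem permSum_cons (b : ℕ) {n : ℕ} (v : Fin n → ℤ) (c : ℤ) (hc : ∀ i, |v i| < |c|) :
    permSum b (Fin.cons c v : Fin (n + 1) → ℤ) =
      stepWeight c c * permSum b v + (-1 : ℤ) ^ b • (s * t * diagDeriv (permSum b v)) := by
  -- `decomposeFin` sends `σ` to `σ 0` and to `σ` with `0` removed from its cycle: the new letter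
  -- is fixed by `decomposeFin.symm (0, e)`, and follows `x` in `decomposeFin.symm ((e x).succ, e)`.
  have hfix (e : Equiv.Perm (Fin n)) :
      ∏ x, stepWeight ((Fin.cons c v : Fin (n + 1) → ℤ) x)
        ((Fin.cons c v : Fin (n + 1) → ℤ) (Equiv.Perm.decomposeFin.symm (0, e) x)) =
      stepWeight c c * ∏ x, stepWeight (v x) (v (e x)) := by
    simp [Fin.prod_univ_succ]
  have hcyc (e : Equiv.Perm (Fin n)) (x : Fin n) :
      ∏ y, stepWeight ((Fin.cons c v : Fin (n + 1) → ℤ) y)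
        ((Fin.cons c v : Fin (n + 1) → ℤ) (Equiv.Perm.decomposeFin.symm ((e x).succ, e) y)) =
      s * t * ∏ y ∈ Finset.univ.erase x, stepWeight (v y) (v (e y)) := by
    rw [Fin.prod_univ_succ, ← Finset.mul_prod_erase _ _ (Finset.mem_univ x), ← mul_assoc]
    congr 1
    · simpa using stepWeight_mul_stepWeight (hc x) (hc (e x))
    · refine Finset.prod_congr rfl fun y hy => ?_
      have hne : (e y).succ ≠ (e x).succ := by
        simpa using Finset.ne_of_mem_erase hy
      rw [Equiv.Perm.decomposeFin_symm_apply_succ,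
        Equiv.swap_apply_of_ne_of_ne (Fin.succ_ne_zero _) hne]
      simp
  have hD (e : Equiv.Perm (Fin n)) :
      diagDeriv (∏ x, stepWeight (v x) (v (e x))) =
        ∑ x, ∏ y ∈ Finset.univ.erase x, stepWeight (v y) (v (e y)) :=
    diagDeriv_prod _ _ fun _ => diagDeriv_stepWeight _ _
  have hsum (e : Equiv.Perm (Fin n)) (F : Fin n → MvPolynomial (Fin 2) ℚ) :
      ∑ j, F j = ∑ x, F (e x) := (Equiv.sum_comp e F).symm
  unfold permSum
  rw [← Equiv.sum_comp Equiv.Perm.decomposeFin.symm, Fintype.sum_prod_type, Fin.sum_univ_succ,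
    Finset.sum_comm, map_sum, Finset.mul_sum, Finset.mul_sum, Finset.smul_sum]
  refine congrArg₂ _ (Finset.sum_congr rfl fun e _ => ?_) (Finset.sum_congr rfl fun e _ => ?_)
  · rw [hfix, Equiv.Perm.decomposeFin.symm_sign, if_pos rfl, one_mul, mul_smul_comm]
  · rw [hsum e, map_zsmul, hD, mul_smul_comm, smul_smul, Finset.mul_sum, Finset.smul_sum]
    refine Finset.sum_congr rfl fun x _ => ?_
    rw [hcyc, Equiv.Perm.decomposeFin.symm_sign, if_neg (Fin.succ_ne_zero _), mul_pow]
    simp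

/-- The integers `± n, …, ± 1` with the signs `ε`, listed by decreasing absolute value, so that
`Fin.cons` adds an integer of larger absolute value. -/
def signedValue {n : ℕ} (ε : Fin n → ℤˣ) (i : Fin n) : ℤ :=
  ε i * (n - (i : ℤ))

theorem signedValue_cons {n : ℕ} (u : ℤˣ) (ε : Fin n → ℤˣ) :
    signedValue (Fin.cons u ε : Fin (n + 1) → ℤˣ) =
      Fin.cons ((u : ℤ) * (n + 1)) (signedValue ε) := by
  funext i
  refine Fin.cases ?_ (fun i => ?_) i
  · simp [signedValue]
  · simp [signedValue]

theorem abs_signedValue {n : ℕ} (ε : Fin n → ℤˣ) (i : Fin n) :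
    |signedValue ε i| = n - (i : ℤ) := by
  have := i.2
  rcases Int.units_eq_one_or (ε i) with h | h <;> simp only [signedValue, h] <;>
    push_cast
  · rw [one_mul, abs_of_nonneg (by omega)]
  · rw [neg_one_mul, abs_neg, abs_of_nonneg (by omega)]

/-- The excedance polynomial of the hyperoctahedral group, twisted by the linear character
`(-1) ^ (a * number of negative entries) * sign |π| ^ b`. A signed permutation is given by
the permutation of the absolute values and by the signs of the values. -/
def twistedExc (a b n : ℕ) : MvPolynomial (Fin 2) ℚ :=
  ∑ ε : Fin n → ℤˣ, (((∏ i, ε i) ^ a : ℤˣ) : ℤ) • permSum b (signedValue ε)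

theorem twistedExc_zero (a b : ℕ) : twistedExc a b 0 = 1 := by
  simp [twistedExc, permSum]

theorem twistedExc_succ (a b n : ℕ) :
    twistedExc a b (n + 1) = (s + (-1) ^ a * t) * twistedExc a b n +
      (1 + (-1) ^ a) * (-1) ^ b * (s * t * diagDeriv (twistedExc a b n)) := by
  have hstep (u : ℤˣ) (ε : Fin n → ℤˣ) :
      permSum b (signedValue (Fin.cons u ε : Fin (n + 1) → ℤˣ)) =
        stepWeight (u * (n + 1)) (u * (n + 1)) * permSum b (signedValue ε) +
          (-1 : ℤ) ^ b • (s * t * diagDeriv (permSum b (signedValue ε))) := by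
    rw [signedValue_cons, permSum_cons]
    intro i
    rw [abs_signedValue, abs_mul]
    have h1 : |(u : ℤ)| = 1 := Int.isUnit_iff_abs_eq.1 u.isUnit
    rw [h1, one_mul, abs_of_nonneg (by positivity)]
    omega
  have hpos : stepWeight (((1 : ℤˣ) : ℤ) * (n + 1)) (((1 : ℤˣ) : ℤ) * (n + 1)) = s := by
    unfold stepWeight
    rw [if_neg]
    push_cast
    omega
  have hneg : stepWeight (((-1 : ℤˣ) : ℤ) * (n + 1)) (((-1 : ℤˣ) : ℤ) * (n + 1)) = t := by
    unfold stepWeight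
    rw [if_pos]
    push_cast
    omega
  have huniv : (Finset.univ : Finset ℤˣ) = {1, -1} := rfl
  unfold twistedExc
  rw [← Equiv.sum_comp (Fin.consEquiv fun _ => ℤˣ), Fintype.sum_prod_type, huniv,
    Finset.sum_pair (by decide), map_sum, Finset.mul_sum, Finset.mul_sum, Finset.mul_sum,
    ← Finset.sum_add_distrib, ← Finset.sum_add_distrib]
  refine Finset.sum_congr rfl fun ε _ => ?_
  have hcons (u : ℤˣ) : (Fin.consEquiv fun _ => ℤˣ) (u, ε) = Fin.cons u ε := rfl
  simp only [hcons, hstep, hpos, hneg, Fin.prod_univ_succ, Fin.cons_zero,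
    Fin.cons_succ, map_zsmul, mul_pow]
  simp only [zsmul_eq_mul]
  push_cast
  ring

end Bivariate

/-! ### Closed forms of the signed excedance sums -/

namespace Bivariate

theorem twistedExc_one (b n : ℕ) : twistedExc 1 b n = (s - t) ^ n := by
  induction n with
  | zero => rw [twistedExc_zero, pow_zero]
  | succ n ih =>
    rw [twistedExc_succ, ih, pow_succ]
    ring

theorem diagDeriv_sub_pow (n : ℕ) : diagDeriv ((s - t) ^ n) = 0 := by
  simp [Derivation.leibniz_pow]

theorem twistedExc_zero_one (m : ℕ) : twistedExc 0 1 (2 * m) = (s - t) ^ (2 * m) := by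
  induction m with
  | zero => rw [mul_zero, twistedExc_zero, pow_zero]
  | succ m ih =>
    have hodd : twistedExc 0 1 (2 * m + 1) = (s + t) * (s - t) ^ (2 * m) := by
      rw [twistedExc_succ, ih, diagDeriv_sub_pow]
      ring
    rw [show 2 * (m + 1) = 2 * m + 1 + 1 by ring, twistedExc_succ, hodd, Derivation.leibniz,
      diagDeriv_sub_pow, map_add, diagDeriv_s, diagDeriv_t, smul_zero, zero_add, smul_eq_mul]
    ring

/-- The number of permutations of `n` letters with `i` left peaks, given by its recurrence. -/
def leftPeak : ℕ → ℕ → ℕ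
  | 0, 0 => 1
  | 0, _ + 1 => 0
  | n + 1, 0 => leftPeak n 0
  | n + 1, i + 1 => (3 + 2 * i) * leftPeak n (i + 1) + (n - 2 * i) * leftPeak n i

theorem leftPeak_zero_right (n : ℕ) : leftPeak n 0 = 1 := by
  induction n with
  | zero => rfl
  | succ n ih => rw [leftPeak, ih]

theorem leftPeak_eq_zero {n i : ℕ} (h : n < 2 * i) : leftPeak n i = 0 := by
  induction n generalizing i with
  | zero =>
    obtain ⟨i, rfl⟩ : ∃ j, i = j + 1 := ⟨i - 1, by omega⟩
    rfl
  | succ n ih =>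
    obtain ⟨i, rfl⟩ : ∃ j, i = j + 1 := ⟨i - 1, by omega⟩
    rw [leftPeak, ih (by omega), Nat.sub_eq_zero_of_le (by omega)]
    simp

theorem leftPeak_le_succ (n i : ℕ) : leftPeak n i ≤ leftPeak (n + 1) i := by
  cases i with
  | zero => rw [leftPeak]
  | succ i =>
    rw [leftPeak]
    nlinarith [Nat.zero_le (leftPeak n (i + 1) * i), Nat.zero_le ((n - 2 * i) * leftPeak n i)]

/-- Passing from `2 m` to `2 m + 2` letters, the left peak numbers grow at least as fast as the
binomial coefficients in Pascal's rule. -/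
theorem three_mul_choose_le_leftPeak {m : ℕ} (hm : 2 ≤ m) (i : ℕ) :
    3 * m.choose (i + 1) ≤ leftPeak (2 * m) (i + 1) := by
  induction m, hm using Nat.le_induction generalizing i with
  | base =>
    match i with
    | 0 => decide
    | 1 => decide
    | i + 2 => simp [Nat.choose_eq_zero_of_lt (show 2 < i + 2 + 1 by omega)]
  | succ m hm ih =>
    rcases Nat.lt_or_ge m i with hi | hi
    · simp [Nat.choose_eq_zero_of_lt (show m + 1 < i + 1 by omega)]
    · have h1 := leftPeak_le_succ (2 * m) (i + 1)
      have h2 := leftPeak_le_succ (2 * m) i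
      have h3 := ih i
      rw [show 2 * (m + 1) = 2 * m + 1 + 1 by ring, leftPeak, Nat.choose_succ_succ]
      have h4 : 3 * leftPeak (2 * m + 1) (i + 1) ≤
          (3 + 2 * i) * leftPeak (2 * m + 1) (i + 1) := Nat.mul_le_mul_right _ (by omega)
      cases i with
      | zero =>
        simp only [leftPeak_zero_right, Nat.choose_zero_right, Nat.succ_eq_add_one] at *
        omega
      | succ i =>
        have h5 : 1 * leftPeak (2 * m + 1) (i + 1) ≤
            (2 * m + 1 - 2 * (i + 1)) * leftPeak (2 * m + 1) (i + 1) :=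
          Nat.mul_le_mul_right _ (by omega)
        have h6 := ih i
        simp only [Nat.succ_eq_add_one] at *
        omega

/-- The operator of the insertion recurrence preserves gamma expansions, as
`diagDeriv (s + t) = 2` and `diagDeriv (s * t) = s + t`. -/
theorem mul_diagDeriv_gamma (i m : ℕ) :
    s * t * diagDeriv ((s * t) ^ i * (s + t) ^ m) =
      i * ((s * t) ^ i * (s + t) ^ (m + 1)) +
        2 * m * ((s * t) ^ (i + 1) * (s + t) ^ (m - 1)) := by
  rw [Derivation.leibniz, Derivation.leibniz_pow, Derivation.leibniz_pow, Derivation.leibniz,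
    map_add, diagDeriv_s, diagDeriv_t]
  simp only [smul_eq_mul, nsmul_eq_mul]
  cases i with
  | zero => push_cast; ring
  | succ i => rw [Nat.add_sub_cancel]; push_cast; ring

theorem twistedExc_zero_zero (n : ℕ) :
    twistedExc 0 0 n = ∑ i ∈ Finset.range (n + 1),
      ((4 ^ i * leftPeak n i : ℕ) : MvPolynomial (Fin 2) ℚ) *
        ((s * t) ^ i * (s + t) ^ (n - 2 * i)) := by
  induction n with
  | zero => simp [twistedExc_zero, leftPeak]
  | succ n ih =>
    have hterm (i : ℕ) : (s + t) * (((4 ^ i * leftPeak n i : ℕ) : MvPolynomial (Fin 2) ℚ) *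
          ((s * t) ^ i * (s + t) ^ (n - 2 * i))) + 2 * (s * t * diagDeriv
          (((4 ^ i * leftPeak n i : ℕ) : MvPolynomial (Fin 2) ℚ) *
          ((s * t) ^ i * (s + t) ^ (n - 2 * i)))) =
        ((4 ^ i * ((1 + 2 * i) * leftPeak n i) : ℕ) : MvPolynomial (Fin 2) ℚ) *
          ((s * t) ^ i * (s + t) ^ (n + 1 - 2 * i)) +
        ((4 ^ (i + 1) * ((n - 2 * i) * leftPeak n i) : ℕ) : MvPolynomial (Fin 2) ℚ) *
          ((s * t) ^ (i + 1) * (s + t) ^ (n + 1 - 2 * (i + 1))) := by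
      rcases Nat.lt_or_ge n (2 * i) with h | h
      · rw [leftPeak_eq_zero h]
        simp
      · rw [← nsmul_eq_mul, map_nsmul, mul_smul_comm, mul_smul_comm (_ : ℕ) (s * t),
          mul_diagDeriv_gamma,
          show n + 1 - 2 * (i + 1) = n - 2 * i - 1 by omega,
          show n + 1 - 2 * i = n - 2 * i + 1 by omega]
        simp only [nsmul_eq_mul]
        push_cast
        ring
    rw [twistedExc_succ, ih]
    norm_num only [pow_zero, one_mul, mul_one]
    rw [map_sum, Finset.mul_sum, Finset.mul_sum, Finset.mul_sum, ← Finset.sum_add_distrib,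
      Finset.sum_congr rfl fun i _ => hterm i, Finset.sum_add_distrib,
      Finset.sum_range_succ' _ (n + 1), Finset.sum_range_succ' _ n]
    have hlast : leftPeak n (n + 1) = 0 := leftPeak_eq_zero (by omega)
    have hext := Finset.sum_range_succ (fun i =>
      ((4 ^ (i + 1) * ((1 + 2 * (i + 1)) * leftPeak n (i + 1)) : ℕ) : MvPolynomial (Fin 2) ℚ) *
        ((s * t) ^ (i + 1) * (s + t) ^ (n + 1 - 2 * (i + 1)))) n
    simp only [hlast, mul_zero, Nat.cast_zero, zero_mul, add_zero] at hext
    rw [← hext, add_right_comm, ← Finset.sum_add_distrib]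
    refine congrArg₂ _ (Finset.sum_congr rfl fun i _ => ?_) ?_
    · rw [leftPeak]
      push_cast
      ring
    · simp [leftPeak]

/-- The homogeneous polynomial of degree `n` with gamma coefficients `γ 0, …, γ (n / 2)`. -/
def gammaSum (n : ℕ) (γ : ℕ → ℚ) : MvPolynomial (Fin 2) ℚ :=
  ∑ i ∈ Finset.range (n / 2 + 1), MvPolynomial.C (γ i) * ((s * t) ^ i * (s + t) ^ (n - 2 * i))

theorem gammaSum_add (n : ℕ) (γ δ : ℕ → ℚ) :
    gammaSum n (fun i => γ i + δ i) = gammaSum n γ + gammaSum n δ := by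
  simp only [gammaSum, map_add, add_mul, Finset.sum_add_distrib]

theorem gammaSum_mul (n : ℕ) (c : ℚ) (γ : ℕ → ℚ) :
    gammaSum n (fun i => c * γ i) = MvPolynomial.C c * gammaSum n γ := by
  simp only [gammaSum, map_mul, mul_assoc, Finset.mul_sum]

theorem twistedExc_zero_zero_eq_gammaSum (n : ℕ) :
    twistedExc 0 0 n = gammaSum n fun i => 4 ^ i * leftPeak n i := by
  rw [twistedExc_zero_zero, gammaSum]
  symm
  refine (Finset.sum_subset (Finset.range_mono (by omega)) fun i _ hi => ?_).trans
    (Finset.sum_congr rfl fun i _ => ?_)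
  · rw [leftPeak_eq_zero (by rw [Finset.mem_range] at hi; omega)]
    simp
  · simp only [map_mul, map_pow, map_natCast, map_ofNat]
    push_cast
    rfl

theorem sub_pow_eq_gammaSum (m : ℕ) :
    (s - t) ^ (2 * m) = gammaSum (2 * m) fun i => (-4) ^ i * m.choose i := by
  rw [gammaSum, pow_mul, show (s - t) ^ 2 = -4 * (s * t) + (s + t) ^ 2 by ring, add_pow,
    Nat.mul_div_cancel_left _ two_pos]
  refine Finset.sum_congr rfl fun i _ => ?_
  rw [← pow_mul, Nat.mul_sub, mul_pow]
  simp only [map_mul, map_pow, map_natCast, map_neg, map_ofNat]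
  ring

/-! ### The center of symmetry of a gamma expansion -/

/-- If the gamma coefficients of index below `r` vanish, then the lowest term of the gamma sum in
powers of `y` is `γ r * x ^ (n - r) * y ^ r`. It is stated for `{x, y} = {s, t}`, so as to yield
both ends of the range of exponents of `t`. -/
theorem dvd_gammaSum_sub {n r : ℕ} {γ : ℕ → ℚ} (hr : 2 * r ≤ n) (hlt : ∀ i < r, γ i = 0)
    {x y : MvPolynomial (Fin 2) ℚ} (hmul : s * t = x * y) (hadd : s + t = x + y) :
    y ^ (r + 1) ∣ gammaSum n γ - MvPolynomial.C (γ r) * (x ^ (n - r) * y ^ r) := by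
  have hmem : r ∈ Finset.range (n / 2 + 1) := by
    rw [Finset.mem_range]
    omega
  rw [gammaSum, ← Finset.add_sum_erase _ _ hmem, add_sub_right_comm]
  refine dvd_add ?_ (Finset.dvd_sum fun i hi => ?_)
  · have h : y ∣ (x + y) ^ (n - 2 * r) - x ^ (n - 2 * r) := by
      simpa using sub_dvd_pow_sub_pow (x + y) x (n - 2 * r)
    obtain ⟨z, hz⟩ := h
    rw [hmul, hadd, ← mul_sub, show n - r = r + (n - 2 * r) by omega]
    refine ⟨MvPolynomial.C (γ r) * (x ^ r * z), ?_⟩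
    linear_combination MvPolynomial.C (γ r) * x ^ r * y ^ r * hz
  · rcases Nat.lt_or_ge i r with h | h
    · simp [hlt i h]
    · have : r + 1 ≤ i := lt_of_le_of_ne h (Finset.ne_of_mem_erase hi).symm
      rw [hmul, mul_pow]
      exact (pow_dvd_pow y this).mul_left _ |>.mul_right _ |>.mul_left _

theorem coeff_X_pow_mul_eq_zero {i : Fin 2} {k : ℕ} {m : Fin 2 →₀ ℕ} (h : m i < k)
    (f : MvPolynomial (Fin 2) ℚ) : (MvPolynomial.X i ^ k * f).coeff m = 0 := by
  rw [MvPolynomial.X_pow_eq_monomial, MvPolynomial.coeff_monomial_mul', if_neg]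
  intro hle
  have := hle i
  simp at this
  omega

/-- The monomial `s ^ a * t ^ b`, as an exponent vector. -/
def expo (a b : ℕ) : Fin 2 →₀ ℕ := Finsupp.single 0 a + Finsupp.single 1 b

@[simp] theorem expo_zero (a b : ℕ) : expo a b 0 = a := by simp [expo]

@[simp] theorem expo_one (a b : ℕ) : expo a b 1 = b := by simp [expo]

theorem coeff_C_mul_expo (c : ℚ) (a b : ℕ) :
    (MvPolynomial.C c * (s ^ a * t ^ b)).coeff (expo a b) = c := by
  rw [MvPolynomial.coeff_C_mul, s, t, MvPolynomial.X_pow_eq_monomial,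
    MvPolynomial.X_pow_eq_monomial, MvPolynomial.monomial_mul, expo]
  simp

theorem coeff_gammaSum_low {n r : ℕ} {γ : ℕ → ℚ} (hr : 2 * r ≤ n) (hlt : ∀ i < r, γ i = 0) :
    (gammaSum n γ).coeff (expo (n - r) r) = γ r := by
  obtain ⟨h, hh⟩ := dvd_gammaSum_sub hr hlt (x := s) (y := t) rfl rfl
  rw [sub_eq_iff_eq_add.1 hh, MvPolynomial.coeff_add, coeff_C_mul_expo, t,
    coeff_X_pow_mul_eq_zero (by simp), zero_add]

theorem coeff_gammaSum_high {n r : ℕ} {γ : ℕ → ℚ} (hr : 2 * r ≤ n) (hlt : ∀ i < r, γ i = 0) :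
    (gammaSum n γ).coeff (expo r (n - r)) = γ r := by
  obtain ⟨h, hh⟩ := dvd_gammaSum_sub hr hlt (x := t) (y := s) (mul_comm _ _) (add_comm _ _)
  rw [sub_eq_iff_eq_add.1 hh, MvPolynomial.coeff_add, mul_comm (t ^ _), coeff_C_mul_expo, s,
    coeff_X_pow_mul_eq_zero (by simp), zero_add]

theorem le_of_mem_support_gammaSum {n r : ℕ} {γ : ℕ → ℚ} (hr : 2 * r ≤ n) (hlt : ∀ i < r, γ i = 0)
    {m : Fin 2 →₀ ℕ} (hm : m ∈ (gammaSum n γ).support) :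
    r ≤ m 1 := by
  obtain ⟨h, hh⟩ := dvd_gammaSum_sub hr hlt (x := s) (y := t) rfl rfl
  by_contra! hlt'
  have hdvd : gammaSum n γ = t ^ r * (t * h + MvPolynomial.C (γ r) * s ^ (n - r)) := by
    rw [sub_eq_iff_eq_add.1 hh]
    ring
  rw [MvPolynomial.mem_support_iff, hdvd] at hm
  exact hm (coeff_X_pow_mul_eq_zero hlt' _)

theorem tDegree_gammaSum_le {n r : ℕ} {γ : ℕ → ℚ} (hlt : ∀ i < r, γ i = 0) :
    tDegree (gammaSum n γ) ≤ n - r := by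
  have hterm (i : ℕ) (hi : 2 * i ≤ n) :
      MvPolynomial.degreeOf 1 ((s * t) ^ i * (s + t) ^ (n - 2 * i)) ≤ n - i := by
    have hs : MvPolynomial.degreeOf 1 s = 0 := MvPolynomial.degreeOf_X_of_ne (by decide)
    have ht : MvPolynomial.degreeOf 1 t = 1 := MvPolynomial.degreeOf_X_self _
    have hmul : MvPolynomial.degreeOf 1 (s * t) ≤ 1 := by
      have := MvPolynomial.degreeOf_mul_le 1 s t
      omega
    have hadd : MvPolynomial.degreeOf 1 (s + t) ≤ 1 := by
      have := MvPolynomial.degreeOf_add_le 1 s t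
      rw [hs, ht] at this
      simpa using this
    have h1 := MvPolynomial.degreeOf_mul_le 1 ((s * t) ^ i) ((s + t) ^ (n - 2 * i))
    have h2 := MvPolynomial.degreeOf_pow_le 1 (s * t) i
    have h3 := MvPolynomial.degreeOf_pow_le 1 (s + t) (n - 2 * i)
    have h4 := Nat.mul_le_mul_left i hmul
    have h5 := Nat.mul_le_mul_left (n - 2 * i) hadd
    omega
  refine (MvPolynomial.degreeOf_sum_le _ _ _).trans (Finset.sup_le fun i hi => ?_)
  rcases Nat.lt_or_ge i r with h | h
  · simp [hlt i h]
  · rw [Finset.mem_range] at hi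
    have := hterm i (by omega)
    exact (MvPolynomial.degreeOf_C_mul_le _ _ _).trans (this.trans (by omega))

theorem centerOfSymmetry_gammaSum {n r : ℕ} {γ : ℕ → ℚ} (hr : 2 * r ≤ n) (hlt : ∀ i < r, γ i = 0)
    (hγ : γ r ≠ 0) :
    centerOfSymmetry (gammaSum n γ) = (n : ℚ) / 2 := by
  have hlow : expo (n - r) r ∈ (gammaSum n γ).support := by
    rwa [MvPolynomial.mem_support_iff, coeff_gammaSum_low hr hlt]
  have hhigh : expo r (n - r) ∈ (gammaSum n γ).support := by
    rwa [MvPolynomial.mem_support_iff, coeff_gammaSum_high hr hlt]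
  have hdeg : tDegree (gammaSum n γ) = n - r :=
    le_antisymm (tDegree_gammaSum_le hlt)
      ((expo_one r (n - r)).ge.trans (MvPolynomial.monomial_le_degreeOf 1 hhigh))
  have hord : tOrder (gammaSum n γ) = r := by
    refine le_antisymm (Nat.sInf_le ⟨_, hlow, expo_one _ _⟩)
      (le_csInf ⟨r, _, hlow, expo_one _ _⟩ ?_)
    rintro k ⟨m, hm, rfl⟩
    exact le_of_mem_support_gammaSum hr hlt hm
  rw [centerOfSymmetry, hdeg, hord, Nat.cast_sub (by omega)]
  ring

theorem isGammaPositive_gammaSum {n r : ℕ} {γ : ℕ → ℚ} (hr : 2 * r ≤ n) (hlt : ∀ i < r, γ i = 0)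
    (hγ : γ r ≠ 0) (hnonneg : ∀ i, 0 ≤ γ i) :
    IsGammaPositive (gammaSum n γ) := by
  refine ⟨fun h => hγ ?_, n, centerOfSymmetry_gammaSum hr hlt hγ, γ, hnonneg, rfl⟩
  rw [← coeff_gammaSum_low hr hlt, h, MvPolynomial.coeff_zero]

end Bivariate

/-! ### Signed permutations as pairs of a permutation and a sign vector -/

namespace SignedPerm

open Bivariate

theorem letter_mem {n : ℕ} (i : Fin n) (u : ℤˣ) :
    (u : ℤ) * (n - (i : ℤ)) ∈ (Finset.Icc (-(n : ℤ)) (n : ℤ)).erase 0 := by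
  have := i.2
  rw [Finset.mem_erase, Finset.mem_Icc]
  rcases Int.units_eq_one_or u with rfl | rfl <;> push_cast <;> omega

/-- The letter `± (n - i)` with the sign `u`. Counting down from `n` makes the letters of
largest absolute value the ones of index `0`, the index at which `Fin.cons` adds a letter. -/
def letter {n : ℕ} (i : Fin n) (u : ℤˣ) : SignedLetter n :=
  ⟨u * (n - (i : ℤ)), letter_mem i u⟩

theorem letter_one_val {n : ℕ} (i : Fin n) : (letter i 1).1 = n - (i : ℤ) := one_mul _

theorem letter_neg_one_val {n : ℕ} (i : Fin n) : (letter i (-1)).1 = -(n - (i : ℤ)) :=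
  neg_one_mul _

theorem letter_neg {n : ℕ} (i : Fin n) (u : ℤˣ) : letter i (-u) = (letter i u).neg :=
  Subtype.ext (by simp [letter, SignedLetter.neg])

theorem letter_abs {n : ℕ} (i : Fin n) (u : ℤˣ) : (letter i u).abs = letter i 1 := by
  have := i.2
  refine Subtype.ext ?_
  rcases Int.units_eq_one_or u with rfl | rfl <;> simp only [letter, SignedLetter.abs] <;>
    push_cast
  · rw [one_mul, abs_of_nonneg (by omega)]
  · rw [neg_one_mul, abs_neg, abs_of_nonneg (by omega), one_mul]

theorem letter_bijective (n : ℕ) :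
    Function.Bijective fun x : Fin n × ℤˣ => letter x.1 x.2 := by
  constructor
  · rintro ⟨i, u⟩ ⟨j, v⟩ h
    have h : (u : ℤ) * (n - (i : ℤ)) = v * (n - (j : ℤ)) := congrArg Subtype.val h
    have hi := i.2
    have hj := j.2
    rcases Int.units_eq_one_or u with rfl | rfl <;> rcases Int.units_eq_one_or v with rfl | rfl <;>
      push_cast at h
    · exact Prod.ext (Fin.ext (by change (i : ℕ) = j; omega)) rfl
    · omega
    · omega
    · exact Prod.ext (Fin.ext (by change (i : ℕ) = j; omega)) rfl
  · rintro ⟨k, hk⟩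
    have hk' := hk
    rw [Finset.mem_erase, Finset.mem_Icc] at hk'
    rcases lt_or_gt_of_ne hk'.1 with h | h
    · refine ⟨(⟨(n + k).toNat, by omega⟩, -1), Subtype.ext ?_⟩
      simp only [letter]
      push_cast
      omega
    · refine ⟨(⟨(n - k).toNat, by omega⟩, 1), Subtype.ext ?_⟩
      simp only [letter]
      push_cast
      omega

/-- The letters, indexed by absolute value and sign. -/
def letterEquiv (n : ℕ) : Fin n × ℤˣ ≃ SignedLetter n :=
  Equiv.ofBijective _ (letter_bijective n)

/-- The action on pairs of an index and a sign of the signed permutation with absolute values `σ`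
whose entry of absolute value `j` has the sign `ε j`. -/
def wreathPerm {n : ℕ} (ε : Fin n → ℤˣ) (σ : Equiv.Perm (Fin n)) :
    Equiv.Perm (Fin n × ℤˣ) where
  toFun x := (σ x.1, x.2 * ε (σ x.1))
  invFun x := (σ.symm x.1, x.2 * ε x.1)
  left_inv x := by simp [mul_assoc]
  right_inv x := by simp [mul_assoc]

/-- The signed permutation with absolute values `σ` whose entry of absolute value `j` has the
sign `ε j`: the signs are attached to the values rather than to the positions. -/
def ofPair {n : ℕ} (x : (Fin n → ℤˣ) × Equiv.Perm (Fin n)) : SignedPerm n :=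
  ⟨(letterEquiv n).permCongr (wreathPerm x.1 x.2), by
    intro k
    obtain ⟨⟨i, u⟩, rfl⟩ := (letterEquiv n).surjective k
    have h : (letterEquiv n (i, u)).neg = letterEquiv n (i, -u) := (letter_neg i u).symm
    rw [h]
    simp only [Equiv.permCongr_apply, Equiv.symm_apply_apply]
    change letter _ (-u * _) = (letter _ (u * _)).neg
    rw [← letter_neg, neg_mul]
    rfl⟩

theorem ofPair_apply {n : ℕ} (ε : Fin n → ℤˣ) (σ : Equiv.Perm (Fin n)) (i : Fin n) (u : ℤˣ) :
    (ofPair (ε, σ)).1 (letter i u) = letter (σ i) (u * ε (σ i)) := by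
  change (letterEquiv n).permCongr (wreathPerm ε σ) (letterEquiv n (i, u)) = _
  rw [Equiv.permCongr_apply, Equiv.symm_apply_apply]
  rfl

theorem letter_inj {n : ℕ} {i j : Fin n} {u v : ℤˣ} (h : letter i u = letter j v) :
    i = j ∧ u = v :=
  Prod.ext_iff.1 ((letter_bijective n).1 (a₁ := (i, u)) (a₂ := (j, v)) h)

theorem ofPair_bijective (n : ℕ) :
    Function.Bijective (ofPair : (Fin n → ℤˣ) × Equiv.Perm (Fin n) → SignedPerm n) := by
  constructor
  · rintro ⟨ε, σ⟩ ⟨δ, τ⟩ h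
    have h' (i : Fin n) : σ i = τ i ∧ 1 * ε (σ i) = 1 * δ (τ i) :=
      letter_inj (by rw [← ofPair_apply, ← ofPair_apply, h])
    obtain rfl : σ = τ := Equiv.ext fun i => (h' i).1
    refine Prod.ext (funext fun j => ?_) rfl
    simpa using (h' (σ.symm j)).2
  · intro π
    have hex (i : Fin n) : ∃ j u, π.1 (letter i 1) = letter j u := by
      obtain ⟨⟨j, u⟩, h⟩ := (letter_bijective n).2 (π.1 (letter i 1))
      exact ⟨j, u, h.symm⟩
    choose f g hfg using hex
    have hfg' (i : Fin n) (u : ℤˣ) : π.1 (letter i u) = letter (f i) (u * g i) := by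
      rcases Int.units_eq_one_or u with rfl | rfl
      · rw [hfg, one_mul]
      · rw [letter_neg, π.2, hfg, ← letter_neg, neg_one_mul]
    have hinj : Function.Injective f := by
      intro i j hij
      have : π.1 (letter i (g i)) = π.1 (letter j (g j)) := by
        rw [hfg', hfg', hij, Int.units_mul_self, Int.units_mul_self]
      exact (letter_inj (π.1.injective this)).1
    let σ : Equiv.Perm (Fin n) := Equiv.ofBijective f (Finite.injective_iff_bijective.1 hinj)
    refine ⟨(fun j => g (σ.symm j), σ), Subtype.ext (Equiv.ext fun k => ?_)⟩
    obtain ⟨⟨i, u⟩, rfl⟩ := (letter_bijective n).2 k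
    change (ofPair _).1 (letter i u) = π.1 (letter i u)
    rw [ofPair_apply, hfg', Equiv.symm_apply_apply]
    rfl

theorem positions_eq_map (n : ℕ) :
    positions n = Finset.univ.map ⟨fun i : Fin n => letter i 1, fun _ _ h => (letter_inj h).1⟩ := by
  ext k
  obtain ⟨⟨i, u⟩, rfl⟩ := (letter_bijective n).2 k
  have hi := i.2
  simp only [positions, Finset.mem_filter, Finset.mem_univ, true_and, Finset.mem_map]
  constructor
  · intro h
    refine ⟨i, ?_⟩
    rcases Int.units_eq_one_or u with rfl | rfl
    · rfl
    · simp only [letter] at h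
      push_cast at h
      omega
  · rintro ⟨j, hj⟩
    obtain ⟨rfl, rfl⟩ := letter_inj hj
    simp only [letter]
    push_cast
    omega

theorem card_filter_positions {n : ℕ} (p : SignedLetter n → Prop) [DecidablePred p] :
    ((positions n).filter p).card = (Finset.univ.filter fun i : Fin n => p (letter i 1)).card := by
  rw [positions_eq_map, Finset.filter_map, Finset.card_map]
  rfl

theorem card_filter_positions_product {n : ℕ} (p : SignedLetter n × SignedLetter n → Prop)
    [DecidablePred p] :
    ((positions n ×ˢ positions n).filter p).card =
      ∑ i : Fin n, ∑ j : Fin n, if p (letter i 1, letter j 1) then 1 else 0 := by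
  rw [Finset.card_filter, Finset.sum_product, positions_eq_map, Finset.sum_map]
  simp only [Finset.sum_map]
  rfl

/-! ### The statistics in terms of pairs -/

/-- Reindexing by `i ↦ σ i` turns the condition `π |π i| > π i` into `v (σ i) > v i`, where
`v = signedValue ε`. -/
theorem excD_ofPair {n : ℕ} (ε : Fin n → ℤˣ) (σ : Equiv.Perm (Fin n)) :
    (ofPair (ε, σ)).excD = (Finset.univ.filter fun i => signedValue ε i < signedValue ε (σ i) ∨
      (signedValue ε i = signedValue ε (σ i) ∧ signedValue ε i < 0)).card := by
  have hval (i : Fin n) : (letter i (ε i)).1 = signedValue ε i := rfl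
  have h1 : (Finset.univ.filter fun i : Fin n =>
      (letter (σ i) (ε (σ i))).1 < (letter (σ (σ i)) (ε (σ (σ i)))).1).card =
      (Finset.univ.filter fun i => signedValue ε i < signedValue ε (σ i)).card := by
    rw [← Finset.card_map σ.toEmbedding]
    congr 1
    ext j
    simp only [hval, Finset.mem_map_equiv, Finset.mem_filter, Finset.mem_univ, true_and,
      Equiv.apply_symm_apply]
  rw [excD, card_filter_positions, card_filter_positions, Finset.filter_or,
    Finset.card_union_of_disjoint]
  · simp only [ofPair_apply, letter_abs, one_mul, gt_iff_lt]
    refine congrArg₂ _ h1 (congrArg Finset.card (Finset.filter_congr fun i _ => ?_))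
    -- Both conditions say that `σ i = i` and `ε i = -1`.
    have hi := i.2
    have hσ := (σ i).2
    constructor
    · intro h
      have hfix : σ i = i := by
        refine Fin.ext ?_
        simp only [letter] at h
        rcases Int.units_eq_one_or (ε (σ i)) with h' | h' <;> rw [h'] at h <;> push_cast at h <;>
          omega
      rw [hfix] at h ⊢
      rw [hval] at h
      refine ⟨rfl, ?_⟩
      rw [h]
      simp only [letter]
      push_cast
      omega
    · rintro ⟨h, hneg⟩
      have habs := congrArg (|·|) h
      simp only [abs_signedValue] at habs
      have hfix : σ i = i := Fin.ext (by omega)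
      have := abs_signedValue ε i
      rw [abs_of_neg hneg] at this
      rw [hfix, hval, letter_one_val]
      omega
  · exact Finset.disjoint_filter.2 fun i _ h h' => h.ne h'.1

theorem t_pow_mul_s_pow_ofPair {n : ℕ} (ε : Fin n → ℤˣ) (σ : Equiv.Perm (Fin n)) :
    t ^ (ofPair (ε, σ)).excD * s ^ (ofPair (ε, σ)).nexcD =
      ∏ i, stepWeight (signedValue ε i) (signedValue ε (σ i)) := by
  unfold stepWeight
  rw [Finset.prod_ite, Finset.prod_const, Finset.prod_const, nexcD, excD_ofPair,
    Finset.filter_not, Finset.card_sdiff_of_subset (Finset.filter_subset _ _)]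
  simp

theorem neg_one_pow_negs_ofPair {n : ℕ} (ε : Fin n → ℤˣ) (σ : Equiv.Perm (Fin n)) :
    (-1 : ℤˣ) ^ (ofPair (ε, σ)).negs.card = ∏ i, ε i := by
  rw [negs, Finset.card_image_of_injective _ (ofPair (ε, σ)).1.injective, card_filter_positions,
    ← Equiv.prod_comp σ ε, Finset.card_filter, ← Finset.prod_pow_eq_pow_sum]
  refine Finset.prod_congr rfl fun i _ => ?_
  have := (σ i).2
  rw [ofPair_apply, one_mul]
  rcases Int.units_eq_one_or (ε (σ i)) with h | h <;> rw [h]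
  · rw [letter_one_val, if_neg (by omega), pow_zero]
  · rw [letter_neg_one_val, if_pos (by omega), pow_one]

/-- The length has the parity of the number of inversions of `|π|`: for positions `p < q`, if
`|π p| > |π q|`, then exactly one of `π p`, `- π p` exceeds `π q`; otherwise both or none do. -/
theorem neg_one_pow_invD_ofPair {n : ℕ} (ε : Fin n → ℤˣ) (σ : Equiv.Perm (Fin n)) :
    (-1 : ℤˣ) ^ (ofPair (ε, σ)).invD = Equiv.Perm.sign σ := by
  rw [invD, inv, card_filter_positions_product, card_filter_positions_product,
    ← Finset.sum_add_distrib, Equiv.Perm.sign_eq_prod_prod_Iio, ← Finset.prod_pow_eq_pow_sum]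
  refine Finset.prod_congr rfl fun i _ => ?_
  rw [← Finset.sum_add_distrib, ← Finset.prod_pow_eq_pow_sum,
    ← Finset.prod_subset (Finset.subset_univ (Finset.Iio i))]
  · refine Finset.prod_congr rfl fun j hj => ?_
    have hj : j < i := Finset.mem_Iio.1 hj
    have hne : ((σ j : Fin n) : ℕ) ≠ σ i := fun h => hj.ne (σ.injective (Fin.ext h))
    have hpos : (letter i (1 : ℤˣ)).1 < (letter j (1 : ℤˣ)).1 := by
      have : (j : ℕ) < i := hj
      simp only [letter]
      push_cast
      omega
    simp only [ofPair_apply, one_mul, hpos, true_and]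
    have h1 := (σ i).2
    have h2 := (σ j).2
    rcases Int.units_eq_one_or (ε (σ i)) with hi | hi <;>
      rcases Int.units_eq_one_or (ε (σ j)) with hj | hj <;>
      simp only [hi, hj, letter_one_val, letter_neg_one_val, Fin.lt_def] <;>
      split_ifs <;> first | omega | rfl
  · intro j _ hj
    have hj : (i : ℕ) ≤ j := not_lt.1 fun h => hj (Finset.mem_Iio.2 h)
    have hpos : ¬ (letter i (1 : ℤˣ)).1 < (letter j (1 : ℤˣ)).1 := by
      simp only [letter]
      push_cast
      omega
    simp [hpos]

theorem twistedExc_eq_sum (a b n : ℕ) :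
    twistedExc a b n = ∑ π : SignedPerm n,
      (((((-1) ^ π.negs.card) ^ a * ((-1) ^ π.invD) ^ b : ℤˣ) : ℤ) : MvPolynomial (Fin 2) ℚ) *
        (t ^ π.excD * s ^ π.nexcD) := by
  rw [← Equiv.sum_comp (Equiv.ofBijective _ (ofPair_bijective n)), Fintype.sum_prod_type]
  simp only [Equiv.ofBijective_apply, neg_one_pow_negs_ofPair, neg_one_pow_invD_ofPair,
    t_pow_mul_s_pow_ofPair, twistedExc, permSum, Finset.smul_sum, smul_smul]
  simp only [← zsmul_eq_mul, Units.val_mul]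

end SignedPerm

namespace Bivariate

open SignedPerm

theorem four_mul_DExcPlus (n : ℕ) :
    4 * DExcPlus n =
      twistedExc 0 0 n + twistedExc 1 0 n + twistedExc 0 1 n + twistedExc 1 1 n := by
  simp only [twistedExc_eq_sum, ← Finset.sum_add_distrib]
  rw [DExcPlus, typeDPlus, typeD, Finset.filter_filter, Finset.sum_filter, Finset.mul_sum]
  refine Finset.sum_congr rfl fun π _ => ?_
  rcases Nat.even_or_odd π.negs.card with h | h <;> rcases Nat.even_or_odd π.invD with h' | h' <;>
    (simp [h.neg_one_pow, h'.neg_one_pow, h, h', Nat.not_even_iff_odd.2]; try ring)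

theorem four_mul_DExcMinus (n : ℕ) :
    4 * DExcMinus n =
      twistedExc 0 0 n + twistedExc 1 0 n - twistedExc 0 1 n - twistedExc 1 1 n := by
  simp only [twistedExc_eq_sum, ← Finset.sum_add_distrib, ← Finset.sum_sub_distrib]
  rw [DExcMinus, typeDMinus, typeDPlus, ← Finset.filter_not, typeD, Finset.filter_filter,
    Finset.sum_filter, Finset.mul_sum]
  refine Finset.sum_congr rfl fun π _ => ?_
  rcases Nat.even_or_odd π.negs.card with h | h <;> rcases Nat.even_or_odd π.invD with h' | h' <;>
    (simp [h.neg_one_pow, h'.neg_one_pow, h, h', Nat.not_even_iff_odd.2]; try ring)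

/-! ### Gamma positivity -/

theorem eq_gammaSum_of_four_mul {f : MvPolynomial (Fin 2) ℚ} {m : ℕ} (c : ℚ)
    (hf : 4 * f = twistedExc 0 0 (2 * m) + MvPolynomial.C c * (s - t) ^ (2 * m)) :
    f = gammaSum (2 * m) fun i =>
      4⁻¹ * (4 ^ i * leftPeak (2 * m) i + c * ((-4) ^ i * m.choose i)) := by
  have h4 : (MvPolynomial.C (4⁻¹ : ℚ) : MvPolynomial (Fin 2) ℚ) * 4 = 1 := by
    rw [← map_ofNat MvPolynomial.C 4, ← map_mul]
    norm_num
  rw [gammaSum_mul, gammaSum_add, gammaSum_mul, ← twistedExc_zero_zero_eq_gammaSum,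
    ← sub_pow_eq_gammaSum, ← hf, ← mul_assoc, h4, one_mul]

theorem abs_mul_choose_le {m : ℕ} (hm : 2 ≤ m) {c : ℚ} (hc : |c| ≤ 3) (i : ℕ) :
    |c * ((-4) ^ (i + 1) * m.choose (i + 1))| ≤ 4 ^ (i + 1) * leftPeak (2 * m) (i + 1) := by
  have h : (3 * m.choose (i + 1) : ℚ) ≤ leftPeak (2 * m) (i + 1) := by
    exact_mod_cast three_mul_choose_le_leftPeak hm i
  rw [abs_mul, abs_mul, abs_pow, abs_neg, Nat.abs_cast, Nat.abs_ofNat]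
  calc |c| * (4 ^ (i + 1) * (m.choose (i + 1) : ℚ))
      ≤ 3 * (4 ^ (i + 1) * (m.choose (i + 1) : ℚ)) := by gcongr
    _ = 4 ^ (i + 1) * (3 * m.choose (i + 1)) := by ring
    _ ≤ _ := by gcongr

end Bivariate

end

open Bivariate

theorem mainTheorem6 (n : ℕ) (hn : 4 ≤ n) (heven : Even n) :
    (Bivariate.IsGammaPositive (DExcPlus n) ∧
      Bivariate.centerOfSymmetry (DExcPlus n) = (n : ℚ) / 2) ∧
    (Bivariate.IsGammaPositive (DExcMinus n) ∧
      Bivariate.centerOfSymmetry (DExcMinus n) = (n : ℚ) / 2) := by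
  obtain ⟨m, rfl⟩ := even_iff_exists_two_mul.1 heven
  have hm : 2 ≤ m := by omega
  have hplus := eq_gammaSum_of_four_mul (f := DExcPlus (2 * m)) (m := m) 3 (by
    rw [four_mul_DExcPlus, twistedExc_one, twistedExc_one, twistedExc_zero_one, map_ofNat]
    ring)
  have hminus := eq_gammaSum_of_four_mul (f := DExcMinus (2 * m)) (m := m) (-1) (by
    rw [four_mul_DExcMinus, twistedExc_one, twistedExc_one, twistedExc_zero_one, map_neg, map_one]
    ring)
  have hplus_nonneg (i : ℕ) :
      0 ≤ (4⁻¹ : ℚ) * (4 ^ i * leftPeak (2 * m) i + 3 * ((-4) ^ i * m.choose i)) := by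
    cases i with
    | zero => simp [leftPeak_zero_right]; norm_num
    | succ i =>
      have := neg_le_of_abs_le (abs_mul_choose_le hm (c := 3) (by norm_num) i)
      linarith
  have hminus_nonneg (i : ℕ) :
      0 ≤ (4⁻¹ : ℚ) * (4 ^ i * leftPeak (2 * m) i + -1 * ((-4) ^ i * m.choose i)) := by
    cases i with
    | zero => simp [leftPeak_zero_right]
    | succ i =>
      have := neg_le_of_abs_le (abs_mul_choose_le hm (c := -1) (by norm_num) i)
      linarith
  refine ⟨?_, ?_⟩
  · rw [hplus]
    have hne : (4⁻¹ : ℚ) * (4 ^ 0 * leftPeak (2 * m) 0 + 3 * ((-4) ^ 0 * m.choose 0)) ≠ 0 := by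
      simp [leftPeak_zero_right]
      norm_num
    exact ⟨isGammaPositive_gammaSum (r := 0) (by omega) (by simp) hne hplus_nonneg,
      centerOfSymmetry_gammaSum (r := 0) (by omega) (by simp) hne⟩
  · rw [hminus]
    -- The identity, of even length, is the only element without excedances, so the gamma
    -- coefficient of index `0` vanishes here.
    have hlt : ∀ i < 1, (4⁻¹ : ℚ) * (4 ^ i * leftPeak (2 * m) i +
        -1 * ((-4) ^ i * m.choose i)) = 0 := by
      intro i hi
      obtain rfl : i = 0 := by omega
      simp [leftPeak_zero_right]
    have hne : (4⁻¹ : ℚ) * (4 ^ 1 * leftPeak (2 * m) 1 + -1 * ((-4) ^ 1 * m.choose 1)) ≠ 0 := by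
      have : (0 : ℚ) < m := by positivity
      have hL : (0 : ℚ) ≤ leftPeak (2 * m) 1 := by positivity
      rw [Nat.choose_one_right, pow_one, pow_one]
      exact ne_of_gt (by linarith)
    exact ⟨isGammaPositive_gammaSum (by omega) hlt hne hminus_nonneg,
      centerOfSymmetry_gammaSum (by omega) hlt hne⟩
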